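/- Let $(\Omega,\mathcal F,\mathbb P)$ be a probability space and let $\mathcal G\subseteq\mathcal F$ be a sub-$\sigma$-algebra. Write $L^p=L^p(\Omega,\mathcal F,\mathbb P)$ and $L^p(\mathcal G)=L^p(\Omega,\mathcal G,\mathbb P|_{\mathcal G})\subseteq L^p$ (random variables that agree a.s. are identified). A map $\rho:L^\infty\to\mathbb R$ is a \emph{coherent risk measure} if $\rho(X+c)=\rho(X)+c$ for $c\in\mathbb R$; $\rho(X)\le\rho(Y)$ whenever $X\le Y$ a.s.; $\rho(\lambda X+(1-\lambda)Y)\le\lambda\rho(X)+(1-\lambda)\rho(Y)$ for $\lambda\in[0,1]$; and $\rho(\lambda X)=\lambda\rho(X)$ for $\lambda\ge 0$. It is \emph{Fatou} if $\rho(X)\le\liminf_{n\to\infty}\rho(X_n)$ for every uniformly bounded sequence $(X_n)$ in $L^\infty$ converging a.s. to $X\in L^\infty$. The same terms are used for maps $L^\infty(\mathcal G)\to\mathbb R$. The map $\rho$ is \emph{$\mathcal G$-law invariant} if $\rho(X)=\rho(Y)$ for all $X,Y\in L^\infty(\mathcal G)$ with the same distribution under $\mathbb P$; a map $\tilde\rho:L^\infty(\mathcal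 G)\to\mathbb R$ is \emph{law invariant} if $\tilde\rho(X)=\tilde\rho(Y)$ for all $X,Y\in L^\infty(\mathcal G)$ with the same distribution under $\mathbb P$. The \emph{supporting set} of $\rho$ is the set $\mathcal S_\rho$ of all probability measures $\mu\ll\mathbb P$ on $(\Omega,\mathcal F)$ such that $\mathbb E^\mu[X]\le\rho(X)$ for all $X\in L^\infty$, and $\widehat{\mathcal S}_\rho=\{\mathrm d\mu/\mathrm d\mathbb P:\mu\in\mathcal S_\rho\}\subseteq L^1$. \textbf{Proposition.} For a Fatou coherent risk measure $\rho:L^\infty\to\mathbb R$ the following are equivalent: (i) there is a Fatou coherent risk measure $\tilde\rho:L^\infty(\mathcal G)\to\mathbb R$ such that $$\rho(X)=\tilde\rho(\mathbb E[X|\mathcal G])\quad\text{for all }X\in L^\infty;\qquad(\ast)$$ (ii) there is a map $\tilde\rho:L^\infty(\mathcal G)\to\mathbb R$ such that $(\ast)$ holds; (iii) $\rho(X)=\rho(\mathbb E[X|\mathcal G])$ for all $X\in L^\infty$; (iv) $\widehat{\mathcal S}_\rho\subseteq L^1(\mathcal G)$. Moreover, for every map $\tilde\rho:L^\infty(\mathcal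 G)\to\mathbb R$ satisfying $(\ast)$, $\rho$ is $\mathcal G$-law invariant if and only if $\tilde\rho$ is law invariant. -/

import Mathlib

open MeasureTheory ProbabilityTheory Filter Topology
open scoped ENNReal

noncomputable section

/-- A coherent risk measure on `L^∞(Ω, m, P)`: cash invariant, monotone, convex and positively
homogeneous (positive values of a random variable are losses). -/
structure IsCoherentRiskMeasure {Ω : Type*} {m : MeasurableSpace Ω} {P : Measure Ω}
    [IsFiniteMeasure P] (ρ : Lp ℝ ∞ P → ℝ) : Prop where
  cash_invariant : ∀ (X : Lp ℝ ∞ P) (c : ℝ), ρ (X + Lp.const ∞ P c) = ρ X + c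
  monotone : ∀ X Y : Lp ℝ ∞ P, X ≤ Y → ρ X ≤ ρ Y
  convex : ∀ (X Y : Lp ℝ ∞ P) (t : ℝ), 0 ≤ t → t ≤ 1 →
    ρ (t • X + (1 - t) • Y) ≤ t * ρ X + (1 - t) * ρ Y
  pos_homogeneous : ∀ (X : Lp ℝ ∞ P) (t : ℝ), 0 ≤ t → ρ (t • X) = t * ρ X

/-- Fatou continuity: `ρ X ≤ liminf ρ (X n)` for every uniformly bounded sequence `X n` in `L^∞`
converging almost surely to `X ∈ L^∞`. The lower limit is taken in the extended reals. -/
def IsFatou {Ω : Type*} {m : MeasurableSpace Ω} {P : Measure Ω} (ρ : Lp ℝ ∞ P → ℝ) : Prop :=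
  ∀ (X : ℕ → Lp ℝ ∞ P) (Y : Lp ℝ ∞ P),
    (∃ C : ℝ, ∀ n, ∀ᵐ ω ∂P, |X n ω| ≤ C) →
    (∀ᵐ ω ∂P, Tendsto (fun n => X n ω) atTop (𝓝 (Y ω))) →
    (ρ Y : EReal) ≤ liminf (fun n => (ρ (X n) : EReal)) atTop

/-- Law invariance of a functional on `L^∞(Ω, m, P)`. -/
def IsLawInvariant {Ω : Type*} {m : MeasurableSpace Ω} {P : Measure Ω}
    (ρ : Lp ℝ ∞ P → ℝ) : Prop :=
  ∀ X Y : Lp ℝ ∞ P, IdentDistrib X Y P P → ρ X = ρ Y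

/-- Partial law invariance with respect to `𝒢`: the value of `ρ` on (classes of) `𝒢`-measurable
random variables depends only on their distribution. -/
def IsPartiallyLawInvariant {Ω : Type*} (𝒢 : MeasurableSpace Ω) {m : MeasurableSpace Ω}
    {P : Measure Ω} (ρ : Lp ℝ ∞ P → ℝ) : Prop :=
  ∀ X Y : Lp ℝ ∞ P, X ∈ lpMeas ℝ ℝ 𝒢 ∞ P → Y ∈ lpMeas ℝ ℝ 𝒢 ∞ P →
    IdentDistrib X Y P P → ρ X = ρ Y

/-- The supporting set: all probability measures `μ ≪ P` with `E^μ[X] ≤ ρ(X)` on `L^∞`. -/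
def supportingSet {Ω : Type*} {m : MeasurableSpace Ω} {P : Measure Ω} (ρ : Lp ℝ ∞ P → ℝ) :
    Set (Measure Ω) :=
  {μ | IsProbabilityMeasure μ ∧ μ ≪ P ∧ ∀ X : Lp ℝ ∞ P, ∫ ω, X ω ∂μ ≤ ρ X}

/-- The set of densities `dμ/dP ∈ L^1` of the measures in the supporting set. -/
def supportingDensities {Ω : Type*} {m : MeasurableSpace Ω} {P : Measure Ω}
    (ρ : Lp ℝ ∞ P → ℝ) : Set (Lp ℝ 1 P) :=
  {D | ∃ μ ∈ supportingSet ρ, D =ᵐ[P] fun ω => (μ.rnDeriv P ω).toReal}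

/-- `L^∞(𝒢)`, the `L^∞` space of `(Ω, 𝒢, P|𝒢)`. -/
abbrev LInftySub {Ω : Type*} {𝒢 m : MeasurableSpace Ω} (P : Measure Ω)
    (h𝒢 : 𝒢 ≤ m) : Type _ :=
  Lp ℝ ∞ (P.trim h𝒢)

/-- The inclusion `L^∞(𝒢) ⊆ L^∞`. -/
def inclLInfty {Ω : Type*} {𝒢 m : MeasurableSpace Ω} {P : Measure Ω}
    (h𝒢 : 𝒢 ≤ m) (X : LInftySub P h𝒢) : Lp ℝ ∞ P :=
  (memLp_of_memLp_trim h𝒢 (Lp.memLp X)).toLp X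

theorem memLp_condExp_trim {Ω : Type*} {𝒢 m : MeasurableSpace Ω} {P : Measure Ω}
    (h𝒢 : 𝒢 ≤ m) (X : Lp ℝ ∞ P) :
    MemLp (P[X | 𝒢]) ∞ (P.trim h𝒢) := by
  refine ⟨stronglyMeasurable_condExp.aestronglyMeasurable, ?_⟩
  rw [eLpNorm_trim h𝒢 stronglyMeasurable_condExp]
  exact ((Lp.memLp X).condExp le_top).2

/-- Conditional expectation `E[· | 𝒢]` as a map from `L^∞` to `L^∞(𝒢)`. -/
def condExpLInfty {Ω : Type*} {𝒢 m : MeasurableSpace Ω} {P : Measure Ω}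
    (h𝒢 : 𝒢 ≤ m) (X : Lp ℝ ∞ P) : LInftySub P h𝒢 :=
  (memLp_condExp_trim h𝒢 X).toLp (P[X | 𝒢])

end

/-! Conditioning fixes `𝒢`-measurable variables, so any `ρt` satisfying (∗) is the restriction of
`ρ` to `L^∞(𝒢)`. This gives the equivalence of the first three conditions and the statement on law
invariance.

For (iii) ⇒ (iv): if `Z` and `W` have equal conditional expectations, then `ρ (Z - W) = ρ 0 = 0`,
and likewise for `W - Z`, so every supporting `μ` integrates them equally. Since conditioning is
self-adjoint, the density of `μ` then equals its own conditional expectation.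

For (iv) ⇒ (iii), supporting measures cannot distinguish `X` from `E[X|𝒢]`, and `ρ` is the supremum
of their expectations (`IsCoherentRiskMeasure.exists_mem_supportingSet_lt`). Only this
representation uses the Fatou property. It rests on a Krein–Šmulian argument in `L^2`: by Fatou, a
shifted acceptance set is `L^2`-closed on sup-norm balls, so an intersection of `L^2`-thickened
balls avoids it. Hahn–Banach then yields a functional bounded on one side over that intersection,
hence continuous for bounded a.s. convergence, hence a measure. -/

/-! ### Closed convex sets in Hilbert space -/

section Hilbert

variable {H : Type*} [NormedAddCommGroup H] [InnerProductSpace ℝ H] [CompleteSpace H]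

/-- A decreasing sequence of nonempty closed convex sets in a Hilbert space, the first of which is
bounded, has nonempty intersection. -/
theorem nonempty_iInter_of_antitone_closed_convex (K : ℕ → Set H) (hK : Antitone K)
    (hcl : ∀ n, IsClosed (K n)) (hcv : ∀ n, Convex ℝ (K n)) (hne : ∀ n, (K n).Nonempty)
    (hb : Bornology.IsBounded (K 0)) : (⋂ n, K n).Nonempty := by
  have hmin : ∀ n, ∃ x ∈ K n, ∀ y ∈ K n, ‖x‖ ≤ ‖y‖ := by
    intro n
    obtain ⟨x, hx, h⟩ := exists_norm_eq_iInf_of_complete_convex (hne n)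
      (hcl n).isComplete (hcv n) (0 : H)
    refine ⟨x, hx, fun y hy => ?_⟩
    have h2 : (⨅ w : K n, ‖(0 : H) - w‖) ≤ ‖(0 : H) - y‖ :=
      ciInf_le ⟨0, by rintro _ ⟨w, rfl⟩; positivity⟩ (⟨y, hy⟩ : K n)
    rw [← h] at h2
    simpa using h2
  choose x hx hxm using hmin
  -- The midpoint of `x n` and `x k` lies in `K n`, so its norm is at least `‖x n‖`; the
  -- parallelogram law does the rest.
  have hsq : ∀ n k, n ≤ k → ‖x n - x k‖ ^ 2 ≤ 2 * (‖x k‖ ^ 2 - ‖x n‖ ^ 2) := by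
    intro n k hnk
    have hmid : (1 / 2 : ℝ) • x n + (1 / 2 : ℝ) • x k ∈ K n :=
      hcv n (hx n) (hK hnk (hx k)) (by norm_num) (by norm_num) (by norm_num)
    have h1 := hxm n _ hmid
    rw [← smul_add, norm_smul] at h1
    norm_num at h1
    have h2 := parallelogram_law_with_norm ℝ (x n) (x k)
    nlinarith [norm_nonneg (x n), norm_nonneg (x n + x k)]
  have hmono : Monotone fun n => ‖x n‖ ^ 2 := by
    intro n k hnk
    have := hxm n _ (hK hnk (hx k))
    dsimp only
    gcongr
  obtain ⟨R, hR⟩ := hb.exists_norm_le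
  have hbdd : BddAbove (Set.range fun n => ‖x n‖ ^ 2) := by
    refine ⟨R ^ 2, ?_⟩
    rintro _ ⟨n, rfl⟩
    have := hR _ (hK (Nat.zero_le n) (hx n))
    dsimp only
    gcongr
  have hcau := (tendsto_atTop_ciSup hmono hbdd).cauchySeq
  have hx_cau : CauchySeq x := by
    rw [Metric.cauchySeq_iff'] at hcau ⊢
    intro ε hε
    obtain ⟨N, hN⟩ := hcau (ε ^ 2 / 2) (by positivity)
    refine ⟨N, fun n hn => ?_⟩
    have h1 := hN n hn
    rw [Real.dist_eq] at h1
    have h2 := hsq N n hn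
    rw [dist_comm, dist_eq_norm]
    have h3 := le_abs_self (‖x n‖ ^ 2 - ‖x N‖ ^ 2)
    exact lt_of_pow_lt_pow_left₀ 2 hε.le (by linarith)
  obtain ⟨y, hy⟩ := cauchySeq_tendsto_of_complete hx_cau
  refine ⟨y, Set.mem_iInter.2 fun n => (hcl n).mem_of_tendsto hy ?_⟩
  filter_upwards [eventually_ge_atTop n] with k hk using hK hk (hx k)

/-- If every thickening failed, the sets `D ∩ B ∩ cthickening (1/(n+1)) A` would be nonempty,
closed, convex, bounded and decreasing. A common point would lie in `D` and at distance zero from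
the closed set `A`. Only `D ∩ B` has to be closed, not `D`. -/
theorem exists_cthickening_disjoint {D A B : Set H} (hD : Convex ℝ D) (hA : Convex ℝ A)
    (hAcl : IsClosed A) (hB : Convex ℝ B) (hBb : Bornology.IsBounded B)
    (hDB : IsClosed (D ∩ B)) (hDA : Disjoint D A) (hAB : A.Nonempty) :
    ∃ ε > 0, Disjoint (D ∩ Metric.cthickening ε A) B := by
  by_contra! hcon
  let K : ℕ → Set H := fun n => D ∩ B ∩ Metric.cthickening (1 / ((n : ℝ) + 1)) A
  have hK : (⋂ n, K n).Nonempty := by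
    apply nonempty_iInter_of_antitone_closed_convex
    · intro n k hnk
      refine Set.inter_subset_inter_right _ (Metric.cthickening_mono ?_ _)
      exact Nat.one_div_le_one_div hnk
    · exact fun n => hDB.inter Metric.isClosed_cthickening
    · exact fun n => (hD.inter hB).inter (hA.cthickening _)
    · intro n
      obtain ⟨x, hx, hxB⟩ := Set.not_disjoint_iff.1 (hcon (1 / ((n : ℝ) + 1)) (by positivity))
      exact ⟨x, ⟨hx.1, hxB⟩, hx.2⟩
    · exact hBb.subset fun x hx => hx.1.2
  obtain ⟨x, hx⟩ := hK
  rw [Set.mem_iInter] at hx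
  refine Set.disjoint_left.1 hDA (hx 0).1.1 ?_
  have h0 : Metric.infDist x A ≤ 0 := by
    refine ge_of_tendsto' tendsto_one_div_add_atTop_nhds_zero_nat fun n => ?_
    exact ENNReal.toReal_le_of_le_ofReal (by positivity) (hx n).2
  exact (hAcl.mem_iff_infDist_zero hAB).2 (le_antisymm h0 Metric.infDist_nonneg)

/-- A Krein–Šmulian type statement: if a convex set `C` meets each member of an increasing sequence
of bounded closed convex sets `B n` in a closed set and avoids `B 0`, then within `⋃ n, B n` it
avoids an intersection of thickenings of the `B n`. -/
theorem exists_iInter_cthickening_disjoint (C : Set H) (hC : Convex ℝ C) (B : ℕ → Set H)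
    (hBm : Monotone B) (hBc : ∀ n, Convex ℝ (B n)) (hBcl : ∀ n, IsClosed (B n))
    (hBb : ∀ n, Bornology.IsBounded (B n)) (hB0 : (B 0).Nonempty)
    (hCB : ∀ n, IsClosed (C ∩ B n)) (hdisj : Disjoint C (B 0)) :
    ∃ ε : ℕ → ℝ, (∀ n, 0 < ε n) ∧
      ∀ x ∈ C, (∀ n, x ∈ Metric.cthickening (ε n) (B n)) → ∀ n, x ∉ B n := by
  -- The hypotheses on `D` sit after the existential so that `choose` gives a radius for every `D`,
  -- with default 1; the recursion defining the sets `D n` can then precede the proof of their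
  -- properties.
  have step : ∀ (D : Set H) (n : ℕ), ∃ ε > 0, Convex ℝ D → (∀ k, IsClosed (D ∩ B k)) →
      Disjoint D (B n) → Disjoint (D ∩ Metric.cthickening ε (B n)) (B (n + 1)) := by
    intro D n
    by_cases h : Convex ℝ D ∧ (∀ k, IsClosed (D ∩ B k)) ∧ Disjoint D (B n)
    · obtain ⟨ε, hε, h'⟩ := exists_cthickening_disjoint h.1 (hBc n) (hBcl n) (hBc (n + 1))
        (hBb (n + 1)) (h.2.1 (n + 1)) h.2.2 (hB0.mono (hBm (Nat.zero_le n)))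
      exact ⟨ε, hε, fun _ _ _ => h'⟩
    · exact ⟨1, one_pos, fun h1 h2 h3 => absurd ⟨h1, h2, h3⟩ h⟩
  choose e he hstep using step
  let D : ℕ → Set H := fun n =>
    Nat.rec C (fun n D => D ∩ Metric.cthickening (e D n) (B n)) n
  have hDs : ∀ n, D (n + 1) = D n ∩ Metric.cthickening (e (D n) n) (B n) := fun n => rfl
  have hD : ∀ n, Convex ℝ (D n) ∧ (∀ k, IsClosed (D n ∩ B k)) ∧ Disjoint (D n) (B n) := by
    intro n
    induction n with
    | zero => exact ⟨hC, hCB, hdisj⟩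
    | succ n ih =>
      obtain ⟨h1, h2, h3⟩ := ih
      refine ⟨?_, fun k => ?_, hstep _ _ h1 h2 h3⟩
      · rw [hDs]
        exact h1.inter ((hBc n).cthickening _)
      · rw [hDs, Set.inter_right_comm]
        exact (h2 k).inter Metric.isClosed_cthickening
  refine ⟨fun n => e (D n) n, fun n => he _ _, fun x hxC hx n hn => ?_⟩
  have hxD : ∀ k, x ∈ D k := by
    intro k
    induction k with
    | zero => exact hxC
    | succ k ih => exact ⟨ih, hx k⟩
  exact Set.disjoint_left.1 (hD n).2.2 (hxD n) hn

end Hilbert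

/-! ### Separation from the acceptance set by a sequentially continuous functional -/

section Separation

variable {Ω : Type*} {m : MeasurableSpace Ω} {P : Measure Ω}

/-- The inclusion of `L^∞` into `L^2` for a finite measure, as a linear map. -/
noncomputable def linftyToL2 (P : Measure Ω) [IsFiniteMeasure P] : Lp ℝ ∞ P →ₗ[ℝ] Lp ℝ 2 P where
  toFun X := ((Lp.memLp X).mono_exponent (p := 2) le_top).toLp X
  map_add' X Y := by
    rw [← MemLp.toLp_add]
    exact MemLp.toLp_congr _ _ (Lp.coeFn_add X Y)
  map_smul' c X := by
    rw [RingHom.id_apply, ← MemLp.toLp_const_smul]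
    exact MemLp.toLp_congr _ _ (Lp.coeFn_smul c X)

theorem coeFn_linftyToL2 [IsFiniteMeasure P] (X : Lp ℝ ∞ P) : linftyToL2 P X =ᵐ[P] X :=
  MemLp.coeFn_toLp ((Lp.memLp X).mono_exponent le_top)

theorem norm_linftyToL2_le [IsProbabilityMeasure P] (X : Lp ℝ ∞ P) : ‖linftyToL2 P X‖ ≤ ‖X‖ := by
  rw [linftyToL2, LinearMap.coe_mk, AddHom.coe_mk, Lp.norm_toLp, Lp.norm_def]
  exact ENNReal.toReal_mono (Lp.eLpNorm_ne_top X)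
    (eLpNorm_le_eLpNorm_of_exponent_le le_top (Lp.aestronglyMeasurable X))

theorem ae_abs_le_norm (X : Lp ℝ ∞ P) : ∀ᵐ ω ∂P, |X ω| ≤ ‖X‖ := by
  have h := ae_le_eLpNormEssSup (f := X) (μ := P)
  filter_upwards [h] with ω hω
  rw [Lp.norm_def, eLpNorm_exponent_top, ← Real.norm_eq_abs, ← toReal_enorm]
  refine ENNReal.toReal_mono ?_ hω
  rw [← eLpNorm_exponent_top]
  exact Lp.eLpNorm_ne_top X

theorem exists_subseq_tendsto_ae_of_tendsto_Lp {p : ℝ≥0∞} [Fact (1 ≤ p)] {f : ℕ → Lp ℝ p P}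
    {g : Lp ℝ p P} (h : Tendsto f atTop (𝓝 g)) :
    ∃ φ : ℕ → ℕ, StrictMono φ ∧ ∀ᵐ ω ∂P, Tendsto (fun n => f (φ n) ω) atTop (𝓝 (g ω)) :=
  (tendstoInMeasure_of_tendsto_Lp h).exists_seq_tendsto_ae

/-- The elements of `L^2` that are almost surely bounded by `n`. -/
def l2Bounded (P : Measure Ω) (n : ℕ) : Set (Lp ℝ 2 P) := {f | ∀ᵐ ω ∂P, |f ω| ≤ n}

theorem monotone_l2Bounded : Monotone (l2Bounded P) := by
  intro k n hkn f hf
  change ∀ᵐ ω ∂P, |f ω| ≤ n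
  change ∀ᵐ ω ∂P, |f ω| ≤ k at hf
  filter_upwards [hf] with ω hω using hω.trans (by exact_mod_cast hkn)

theorem zero_mem_l2Bounded (n : ℕ) : (0 : Lp ℝ 2 P) ∈ l2Bounded P n := by
  change ∀ᵐ ω ∂P, |(0 : Lp ℝ 2 P) ω| ≤ n
  filter_upwards [Lp.coeFn_zero ℝ 2 P] with ω hω
  rw [hω]
  simp

theorem convex_l2Bounded (n : ℕ) : Convex ℝ (l2Bounded P n) := by
  intro f hf g hg a b ha hb hab
  filter_upwards [hf, hg, Lp.coeFn_add (a • f) (b • g), Lp.coeFn_smul a f, Lp.coeFn_smul b g]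
    with ω h1 h2 h3 h4 h5
  rw [h3, Pi.add_apply, h4, h5, Pi.smul_apply, Pi.smul_apply, smul_eq_mul, smul_eq_mul]
  have h1' := abs_le.1 h1
  have h2' := abs_le.1 h2
  have : b = 1 - a := by linarith
  subst this
  rw [abs_le]
  constructor <;> nlinarith

theorem isBounded_l2Bounded [IsFiniteMeasure P] (n : ℕ) : Bornology.IsBounded (l2Bounded P n) := by
  refine isBounded_iff_forall_norm_le.2 ⟨P.real Set.univ ^ (2 : ℝ≥0∞).toReal⁻¹ * n, fun f hf => ?_⟩
  exact Lp.norm_le_of_ae_bound (p := 2) (C := n) (by positivity) hf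

theorem isClosed_l2Bounded (n : ℕ) : IsClosed (l2Bounded P n) := by
  refine IsSeqClosed.isClosed fun f g hf hg => ?_
  obtain ⟨φ, -, hφ⟩ := exists_subseq_tendsto_ae_of_tendsto_Lp hg
  filter_upwards [ae_all_iff.2 fun k => hf (φ k), hφ] with ω h1 h2
  exact le_of_tendsto' h2.abs h1

theorem eq_zero_of_mem_l2Bounded_zero {f : Lp ℝ 2 P} (hf : f ∈ l2Bounded P 0) : f = 0 := by
  rw [Lp.eq_zero_iff_ae_eq_zero]
  filter_upwards [hf] with ω hω
  simpa using hω

theorem memLp_top_of_mem_l2Bounded {n : ℕ} {f : Lp ℝ 2 P} (hf : f ∈ l2Bounded P n) :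
    MemLp f ∞ P :=
  memLp_top_of_bound (Lp.aestronglyMeasurable f) n hf

theorem linftyToL2_mem_l2Bounded [IsFiniteMeasure P] {X : Lp ℝ ∞ P} {n : ℕ}
    (h : ∀ᵐ ω ∂P, |X ω| ≤ n) : linftyToL2 P X ∈ l2Bounded P n := by
  filter_upwards [h, coeFn_linftyToL2 X] with ω h1 h2
  rwa [h2]

theorem linftyToL2_injective [IsFiniteMeasure P] : Function.Injective (linftyToL2 P) := by
  intro X Y h
  apply Lp.ext
  exact (coeFn_linftyToL2 X).symm.trans (h ▸ coeFn_linftyToL2 Y)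

/-- Bounded almost sure convergence in `L^∞` implies convergence in `L^2`. -/
theorem tendsto_linftyToL2_of_tendsto_ae [IsFiniteMeasure P] {X : ℕ → Lp ℝ ∞ P} {Y : Lp ℝ ∞ P}
    {C : ℝ} (hC : ∀ n, ∀ᵐ ω ∂P, |X n ω| ≤ C)
    (hX : ∀ᵐ ω ∂P, Tendsto (fun n => X n ω) atTop (𝓝 (Y ω))) :
    Tendsto (fun n => linftyToL2 P (X n)) atTop (𝓝 (linftyToL2 P Y)) := by
  rw [Lp.tendsto_Lp_iff_tendsto_eLpNorm']
  have hrw : ∀ n, eLpNorm (⇑(linftyToL2 P (X n)) - ⇑(linftyToL2 P Y)) 2 P =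
      (∫⁻ ω, ENNReal.ofReal ((X n ω - Y ω) ^ 2) ∂P) ^ (1 / 2 : ℝ) := by
    intro n
    rw [eLpNorm_congr_ae ((coeFn_linftyToL2 (X n)).sub (coeFn_linftyToL2 Y)),
      eLpNorm_eq_lintegral_rpow_enorm_toReal two_ne_zero ENNReal.ofNat_ne_top]
    simp only [ENNReal.toReal_ofNat, Pi.sub_apply, ENNReal.rpow_two]
    congr 2
    ext ω
    rw [Real.enorm_eq_ofReal_abs, ← ENNReal.ofReal_pow (abs_nonneg _), sq_abs]
  simp_rw [hrw]
  have hY : ∀ᵐ ω ∂P, |Y ω| ≤ C := by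
    filter_upwards [ae_all_iff.2 hC, hX] with ω h1 h2
    exact le_of_tendsto' h2.abs h1
  have hlim : Tendsto (fun n => ∫⁻ ω, ENNReal.ofReal ((X n ω - Y ω) ^ 2) ∂P) atTop
      (𝓝 (∫⁻ _, 0 ∂P)) := by
    refine tendsto_lintegral_of_dominated_convergence' (fun _ => ENNReal.ofReal ((2 * C) ^ 2))
      ?_ ?_ ?_ ?_
    · intro n
      exact (((Lp.aestronglyMeasurable (X n)).aemeasurable.sub
        (Lp.aestronglyMeasurable Y).aemeasurable).pow_const 2).ennreal_ofReal
    · intro n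
      filter_upwards [hC n, hY] with ω h1 h2
      apply ENNReal.ofReal_le_ofReal
      rw [abs_le] at h1 h2
      apply sq_le_sq'  <;> linarith [h1.1, h1.2, h2.1, h2.2]
    · rw [lintegral_const]
      exact ENNReal.mul_ne_top ENNReal.ofReal_ne_top (measure_ne_top _ _)
    · filter_upwards [hX] with ω hω
      have := ENNReal.tendsto_ofReal (((hω.sub_const (Y ω))).pow 2)
      simpa using this
  have := ((ENNReal.continuous_rpow_const (y := (1 / 2 : ℝ))).tendsto _).comp hlim
  simpa [Function.comp_def] using this

variable [IsProbabilityMeasure P] {ρ : Lp ℝ ∞ P → ℝ}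

/-- The image in `L^2` of the shifted acceptance set of `ρ` is closed on bounded sets. -/
theorem IsFatou.isClosed_image_inter_l2Bounded (hF : IsFatou ρ) (X₀ : Lp ℝ ∞ P) (n : ℕ) :
    IsClosed (linftyToL2 P '' {Z | ρ (Z + X₀) ≤ 0} ∩ l2Bounded P n) := by
  refine IsSeqClosed.isClosed fun f g hf hg => ?_
  have hgB : g ∈ l2Bounded P n :=
    (isClosed_l2Bounded n).mem_of_tendsto hg (Eventually.of_forall fun k => (hf k).2)
  refine ⟨?_, hgB⟩
  choose Z hZ hZf using fun k => (hf k).1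
  obtain ⟨φ, -, hφ⟩ := exists_subseq_tendsto_ae_of_tendsto_Lp hg
  let Y : Lp ℝ ∞ P := (memLp_top_of_mem_l2Bounded hgB).toLp g
  have hYg : Y =ᵐ[P] g := MemLp.coeFn_toLp _
  refine ⟨Y, ?_, Lp.ext ((coeFn_linftyToL2 Y).trans hYg)⟩
  have hZ' : ∀ k, Z k =ᵐ[P] f k := fun k => by
    rw [← hZf k]
    exact (coeFn_linftyToL2 _).symm
  have key := hF (fun k => Z (φ k) + X₀) (Y + X₀) ⟨n + ‖X₀‖, fun k => ?_⟩ ?_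
  · have h2 : liminf (fun k => (ρ (Z (φ k) + X₀) : EReal)) atTop ≤ 0 := by
      refine (liminf_le_liminf (v := fun _ : ℕ => (0 : EReal))
        (Eventually.of_forall fun k => ?_)).trans
        (liminf_const 0).le
      exact_mod_cast hZ (φ k)
    exact_mod_cast key.trans h2
  · filter_upwards [Lp.coeFn_add (Z (φ k)) X₀, hZ' (φ k), (hf (φ k)).2, ae_abs_le_norm X₀]
      with ω h1 h2 h3 h4
    rw [h1, Pi.add_apply, h2]
    exact (abs_add_le _ _).trans (add_le_add h3 h4)
  · filter_upwards [ae_all_iff.2 fun k => Lp.coeFn_add (Z (φ k)) X₀, ae_all_iff.2 fun k => hZ' (φ k),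
      hφ, hYg, Lp.coeFn_add Y X₀] with ω h1 h2 h3 h4 h5
    simp_rw [h1, h5, Pi.add_apply, h2, h4]
    exact h3.add_const _

theorem IsCoherentRiskMeasure.apply_zero (hρ : IsCoherentRiskMeasure ρ) : ρ 0 = 0 := by
  simpa using hρ.pos_homogeneous 0 0 le_rfl

theorem IsCoherentRiskMeasure.convex_shifted (hρ : IsCoherentRiskMeasure ρ) (X₀ : Lp ℝ ∞ P) :
    Convex ℝ {Z | ρ (Z + X₀) ≤ 0} := by
  intro X hX Y hY a b ha hb hab
  obtain rfl : b = 1 - a := by linarith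
  have h := hρ.convex (X + X₀) (Y + X₀) a ha (by linarith)
  have he : a • (X + X₀) + (1 - a) • (Y + X₀) = a • X + (1 - a) • Y + X₀ := by module
  rw [he] at h
  simp only [Set.mem_ofPred_eq] at hX hY ⊢
  nlinarith

/-- Every position of positive risk is strictly separated from the acceptance set of a Fatou
coherent risk measure by a linear functional that is continuous for bounded almost sure
convergence. -/
theorem IsCoherentRiskMeasure.exists_separating (hρ : IsCoherentRiskMeasure ρ) (hF : IsFatou ρ)
    {X₀ : Lp ℝ ∞ P} (hX₀ : 0 < ρ X₀) :
    ∃ g : Lp ℝ ∞ P →L[ℝ] ℝ, (∀ Y, ρ Y ≤ 0 → g Y ≤ 0) ∧ 0 < g X₀ ∧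
      ∀ (X : ℕ → Lp ℝ ∞ P) (Y : Lp ℝ ∞ P) (C : ℝ), (∀ n, ∀ᵐ ω ∂P, |X n ω| ≤ C) →
        (∀ᵐ ω ∂P, Tendsto (fun n => X n ω) atTop (𝓝 (Y ω))) →
        Tendsto (fun n => g (X n)) atTop (𝓝 (g Y)) := by
  set T : Set (Lp ℝ ∞ P) := {Z | ρ (Z + X₀) ≤ 0} with hT
  have hTc : Convex ℝ T := hρ.convex_shifted X₀
  obtain ⟨ε, hε, hdisj⟩ := exists_iInter_cthickening_disjoint (linftyToL2 P '' T)
    (hTc.linear_image _) (l2Bounded P) monotone_l2Bounded convex_l2Bounded isClosed_l2Bounded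
    isBounded_l2Bounded ⟨0, zero_mem_l2Bounded 0⟩ (hF.isClosed_image_inter_l2Bounded X₀) (by
      -- The ball of radius 0 is `{0}`, and `0 ∉ T` because `ρ X₀ > 0`.
      rw [Set.disjoint_left]
      rintro _ ⟨Z, hZ, rfl⟩ h0
      have h1 : Z = 0 := linftyToL2_injective
        ((eq_zero_of_mem_l2Bounded_zero h0).trans (map_zero _).symm)
      rw [h1, hT, Set.mem_ofPred_eq, zero_add] at hZ
      exact hX₀.not_ge hZ)
  set V : Set (Lp ℝ ∞ P) :=
    {Z | ∀ n, linftyToL2 P Z ∈ Metric.cthickening (ε n) (l2Bounded P n)} with hV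
  have hVc : Convex ℝ V := by
    have : V = ⋂ n, linftyToL2 P ⁻¹' Metric.cthickening (ε n) (l2Bounded P n) := by
      ext Z
      simp [hV]
    rw [this]
    exact convex_iInter fun n => ((convex_l2Bounded n).cthickening _).linear_preimage _
  have hthick : ∀ (n : ℕ) (f : Lp ℝ 2 P), ‖f‖ ≤ ε n →
      f ∈ Metric.cthickening (ε n) (l2Bounded P n) := fun n f hf =>
    Metric.mem_cthickening_of_dist_le f 0 _ _ (zero_mem_l2Bounded n) (by simpa using hf)
  have h0V : (0 : Lp ℝ ∞ P) ∈ interior V := by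
    rw [mem_interior_iff_mem_nhds]
    -- The bound `ε 0` handles the thickening of `{0}`; the bound 1 puts `Z` in every ball of radius
    -- at least 1.
    refine mem_of_superset (Metric.ball_mem_nhds 0 (lt_min one_pos (hε 0))) fun Z hZ n => ?_
    rw [mem_ball_zero_iff, lt_min_iff] at hZ
    rcases n with _ | n
    · exact hthick _ _ ((norm_linftyToL2_le Z).trans hZ.2.le)
    · refine Metric.self_subset_cthickening _ (linftyToL2_mem_l2Bounded ?_)
      filter_upwards [ae_abs_le_norm Z] with ω hω
      refine (hω.trans hZ.1.le).trans ?_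
      exact_mod_cast Nat.le_add_left 1 n
  have hVT : Disjoint (interior V) T := by
    rw [Set.disjoint_left]
    intro Z hZV hZT
    obtain ⟨n, hn⟩ := exists_nat_ge ‖Z‖
    refine hdisj _ ⟨Z, hZT, rfl⟩ (interior_subset hZV) n (linftyToL2_mem_l2Bounded ?_)
    filter_upwards [ae_abs_le_norm Z] with ω hω using hω.trans hn
  obtain ⟨f, u, hfV, hfT⟩ := geometric_hahn_banach_open hVc.interior isOpen_interior hTc hVT
  have hu : 0 < u := by simpa using hfV 0 h0V
  have hfA : ∀ Y, ρ Y ≤ 0 → u + f X₀ ≤ f Y := by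
    intro Y hY
    have h := hfT (Y - X₀) (by simpa [hT] using hY)
    rw [map_sub] at h
    linarith
  -- `f < u` is known only on the interior of `V`; halving a point of `V` moves it there.
  have hfV2 : ∀ Z ∈ V, f Z < 2 * u := by
    intro Z hZ
    have hmem : (1 / 2 : ℝ) • Z + (1 / 2 : ℝ) • (0 : Lp ℝ ∞ P) ∈ interior V :=
      hVc.combo_self_interior_mem_interior hZ h0V (by norm_num) (by norm_num) (by norm_num)
    have h := hfV _ hmem
    rw [smul_zero, add_zero, map_smul, smul_eq_mul] at h
    linarith
  have hev : ∀ (Z : ℕ → Lp ℝ ∞ P) (C : ℝ), (∀ n, ∀ᵐ ω ∂P, |Z n ω| ≤ C) →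
      Tendsto (fun n => linftyToL2 P (Z n)) atTop (𝓝 0) → ∀ δ > 0, ∀ᶠ n in atTop, f (Z n) < δ := by
    intro Z C hC hZ δ hδ
    -- With this scale, `t • Z n ∈ V` gives `f (Z n) < δ`. For `k ≥ N ≥ t * C` the point already
    -- lies in the `k`-th ball, so only finitely many `L^2` conditions remain.
    set t : ℝ := 2 * u / δ with ht
    have htp : 0 < t := by positivity
    obtain ⟨N, hN⟩ := exists_nat_ge (t * C)
    have hall : ∀ᶠ n in atTop, ∀ k ∈ Finset.range N, ‖linftyToL2 P (t • Z n)‖ < ε k := by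
      rw [Filter.eventually_all_finset]
      intro k _
      have h1 : Tendsto (fun n => ‖linftyToL2 P (t • Z n)‖) atTop (𝓝 0) := by
        simpa using (hZ.const_smul t).norm
      exact h1.eventually (gt_mem_nhds (hε k))
    filter_upwards [hall] with n hn
    have hmem : t • Z n ∈ V := by
      intro k
      rcases lt_or_ge k N with hk | hk
      · exact hthick _ _ (hn k (Finset.mem_range.2 hk)).le
      · refine Metric.self_subset_cthickening _ (linftyToL2_mem_l2Bounded ?_)
        filter_upwards [hC n, Lp.coeFn_smul t (Z n)] with ω h1 h2
        rw [h2, Pi.smul_apply, smul_eq_mul, abs_mul, abs_of_pos htp]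
        refine ((mul_le_mul_of_nonneg_left h1 htp.le).trans hN).trans ?_
        exact_mod_cast hk
    have h := hfV2 _ hmem
    rw [map_smul, smul_eq_mul, ht, div_mul_eq_mul_div, div_lt_iff₀ hδ] at h
    exact lt_of_mul_lt_mul_left h (by positivity)
  refine ⟨-f, fun Y hY => ?_, ?_, fun X Y C hC hX => ?_⟩
  · by_contra! hneg
    rw [neg_apply, neg_pos] at hneg
    -- Acceptable positions form a cone on which `f` is bounded below; a negative value at `Y`
    -- would, scaled by `s`, fall under the bound `u + f X₀`.
    set s : ℝ := (|u + f X₀| + 1) / (-f Y) with hs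
    have hfY : 0 < -f Y := by linarith
    have hsp : 0 ≤ s := by positivity
    have h := hfA (s • Y) (by
      rw [hρ.pos_homogeneous Y s hsp]
      exact mul_nonpos_of_nonneg_of_nonpos hsp hY)
    rw [map_smul, smul_eq_mul] at h
    have h2 : s * (-f Y) = |u + f X₀| + 1 := div_mul_cancel₀ _ hfY.ne'
    linarith [neg_abs_le (u + f X₀)]
  · have h := hfA 0 hρ.apply_zero.le
    rw [map_zero] at h
    rw [neg_apply]
    linarith
  · have hY : ∀ᵐ ω ∂P, |Y ω| ≤ C := by
      filter_upwards [ae_all_iff.2 hC, hX] with ω h1 h2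
      exact le_of_tendsto' h2.abs h1
    have hL2 := tendsto_linftyToL2_of_tendsto_ae hC hX
    have h1 := hev (fun n => X n - Y) (C + C) (fun n => by
      filter_upwards [hC n, hY, Lp.coeFn_sub (X n) Y] with ω h1 h2 h3
      rw [h3, Pi.sub_apply]
      exact (abs_sub _ _).trans (add_le_add h1 h2)) (by simpa using hL2.sub_const (linftyToL2 P Y))
    have h2 := hev (fun n => Y - X n) (C + C) (fun n => by
      filter_upwards [hC n, hY, Lp.coeFn_sub Y (X n)] with ω h1 h2 h3
      rw [h3, Pi.sub_apply]
      exact (abs_sub _ _).trans (add_le_add h2 h1)) (by simpa using hL2.const_sub (linftyToL2 P Y))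
    rw [Metric.tendsto_nhds]
    intro δ hδ
    filter_upwards [h1 δ hδ, h2 δ hδ] with n h3 h4
    rw [map_sub] at h3 h4
    rw [Real.dist_eq, abs_lt, neg_apply, neg_apply]
    constructor <;> linarith

end Separation

/-! ### Dual representation by absolutely continuous probability measures -/

section Representation

variable {Ω : Type*} {m : MeasurableSpace Ω} {P : Measure Ω}

/-- A positive linear functional on `L^∞` that is continuous for bounded almost sure convergence
is integration against a finite measure that is absolutely continuous. -/
theorem exists_measure_of_tendsto_of_tendsto_ae [IsFiniteMeasure P] (g : Lp ℝ ∞ P →ₗ[ℝ] ℝ)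
    (hpos : ∀ X, 0 ≤ X → 0 ≤ g X)
    (hcont : ∀ (X : ℕ → Lp ℝ ∞ P) (Y : Lp ℝ ∞ P) (C : ℝ), (∀ n, ∀ᵐ ω ∂P, |X n ω| ≤ C) →
        (∀ᵐ ω ∂P, Tendsto (fun n => X n ω) atTop (𝓝 (Y ω))) →
        Tendsto (fun n => g (X n)) atTop (𝓝 (g Y))) :
    ∃ μ : Measure Ω, IsFiniteMeasure μ ∧ μ ≪ P ∧ ∀ X : Lp ℝ ∞ P, ∫ ω, X ω ∂μ = g X := by
  let I : ∀ A : Set Ω, MeasurableSet A → Lp ℝ ∞ P := fun A hA =>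
    indicatorConstLp ∞ hA (measure_ne_top P A) (1 : ℝ)
  have hI : ∀ A hA, I A hA =ᵐ[P] A.indicator fun _ => (1 : ℝ) := fun A hA =>
    indicatorConstLp_coeFn
  have hI0 : ∀ A hA, 0 ≤ g (I A hA) := by
    intro A hA
    refine hpos _ ((Lp.coeFn_nonneg _).1 ?_)
    filter_upwards [hI A hA] with ω hω
    rw [hω]
    exact Set.indicator_nonneg (fun _ _ => zero_le_one) ω
  -- Countable additivity is continuity of `g` along partial sums of indicators, which are bounded
  -- by 1 by disjointness.
  have hsum : ∀ (f : ℕ → Set Ω) (hf : ∀ k, MeasurableSet (f k)), Pairwise (Function.onFun Disjoint f) →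
      HasSum (fun k => g (I (f k) (hf k))) (g (I (⋃ k, f k) (MeasurableSet.iUnion hf))) := by
    intro f hf hd
    rw [hasSum_iff_tendsto_nat_of_nonneg fun k => hI0 _ _]
    simp_rw [← map_sum]
    have hpt : ∀ ω, HasSum (fun k => (f k).indicator (fun _ => (1 : ℝ)) ω)
        ((⋃ k, f k).indicator (fun _ => (1 : ℝ)) ω) := by
      intro ω
      by_cases hω : ω ∈ ⋃ k, f k
      · obtain ⟨j, hj⟩ := Set.mem_iUnion.1 hω
        have h := hasSum_single (f := fun k => (f k).indicator (fun _ => (1 : ℝ)) ω) j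
          fun k hk => Set.indicator_of_notMem (fun hk' => Set.disjoint_left.1 (hd hk) hk' hj) _
        simp only [Set.indicator_of_mem hj] at h
        rwa [Set.indicator_of_mem hω]
      · rw [Set.indicator_of_notMem hω]
        have h0 : ∀ k, (f k).indicator (fun _ => (1 : ℝ)) ω = 0 := fun k =>
          Set.indicator_of_notMem (fun h => hω (Set.mem_iUnion.2 ⟨k, h⟩)) _
        simp_rw [h0]
        exact hasSum_zero
    have hS : ∀ n, ⇑(∑ k ∈ Finset.range n, I (f k) (hf k)) =ᵐ[P]
        fun ω => ∑ k ∈ Finset.range n, (f k).indicator (fun _ => (1 : ℝ)) ω := by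
      intro n
      induction n with
      | zero =>
        simp only [Finset.range_zero, Finset.sum_empty]
        exact Lp.coeFn_zero ℝ ∞ P
      | succ n ih =>
        rw [Finset.sum_range_succ]
        filter_upwards [Lp.coeFn_add (∑ k ∈ Finset.range n, I (f k) (hf k)) (I (f n) (hf n)), ih,
          hI (f n) (hf n)] with ω h1 h2 h3
        rw [h1, Pi.add_apply, h2, h3, Finset.sum_range_succ]
    refine hcont _ _ 1 (fun n => ?_) ?_
    · filter_upwards [hS n] with ω hω
      have h0 : ∀ k, 0 ≤ (f k).indicator (fun _ => (1 : ℝ)) ω := fun k =>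
        Set.indicator_nonneg (fun _ _ => zero_le_one) ω
      rw [hω, abs_of_nonneg (Finset.sum_nonneg fun k _ => h0 k)]
      exact (sum_le_hasSum _ (fun k _ => h0 k) (hpt ω)).trans
        (Set.indicator_le_self' (fun _ _ => zero_le_one) ω)
    · filter_upwards [ae_all_iff.2 hS, hI _ (MeasurableSet.iUnion hf)] with ω h1 h2
      simp_rw [h1, h2]
      exact (hpt ω).tendsto_sum_nat
  have hIzero : ∀ A hA, P A = 0 → I A hA = 0 := by
    intro A hA h
    rw [Lp.eq_zero_iff_ae_eq_zero]
    exact (hI A hA).trans (indicator_meas_zero h)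
  let μ : Measure Ω := Measure.ofMeasurable (fun A hA => ENNReal.ofReal (g (I A hA)))
    (by rw [hIzero _ _ measure_empty, map_zero, ENNReal.ofReal_zero])
    (fun f hf hd => by
      rw [← (hsum f hf hd).tsum_eq, ENNReal.ofReal_tsum_of_nonneg (fun k => hI0 _ _)
        (hsum f hf hd).summable])
  have hμ : ∀ A hA, μ A = ENNReal.ofReal (g (I A hA)) := fun A hA =>
    Measure.ofMeasurable_apply A hA
  have hfin : IsFiniteMeasure μ := ⟨by
    rw [hμ _ MeasurableSet.univ]
    exact ENNReal.ofReal_lt_top⟩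
  have hac : μ ≪ P := Measure.AbsolutelyContinuous.mk fun A hA h => by
    rw [hμ A hA, hIzero A hA h, map_zero, ENNReal.ofReal_zero]
  refine ⟨μ, hfin, hac, fun X => ?_⟩
  have hsimple : ∀ s : SimpleFunc Ω ℝ, ∫ ω, s ω ∂μ =
      g ((SimpleFunc.memLp_of_isFiniteMeasure s ∞ P).toLp s) := by
    intro s
    induction s using SimpleFunc.induction with
    | const c hA =>
      rename_i A
      set t := SimpleFunc.piecewise A hA (SimpleFunc.const Ω c) (SimpleFunc.const Ω 0) with ht
      have he : (SimpleFunc.memLp_of_isFiniteMeasure t ∞ P).toLp t = c • I A hA := by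
        apply Lp.ext
        filter_upwards [MemLp.coeFn_toLp (SimpleFunc.memLp_of_isFiniteMeasure t ∞ P),
          Lp.coeFn_smul c (I A hA), hI A hA] with ω h1 h2 h3
        rw [h1, h2, Pi.smul_apply, h3]
        by_cases hω : ω ∈ A <;> simp [ht, hω]
      rw [he, map_smul, smul_eq_mul]
      have hint : ∀ ω, t ω = A.indicator (fun _ => c) ω := fun ω => by
        by_cases hω : ω ∈ A <;> simp [ht, hω]
      simp_rw [hint]
      rw [integral_indicator_const c hA, measureReal_def, hμ A hA,
        ENNReal.toReal_ofReal (hI0 A hA), smul_eq_mul, mul_comm]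
    | @add s t _ hs ht =>
      have he : (SimpleFunc.memLp_of_isFiniteMeasure (s + t) ∞ P).toLp (s + t) =
          (SimpleFunc.memLp_of_isFiniteMeasure s ∞ P).toLp s +
            (SimpleFunc.memLp_of_isFiniteMeasure t ∞ P).toLp t := by
        rw [← MemLp.toLp_add]
        exact MemLp.toLp_congr _ _ (by simp)
      simp only [SimpleFunc.coe_add, Pi.add_apply] at he ⊢
      rw [he, map_add, ← hs, ← ht]
      exact integral_add (SimpleFunc.integrable_of_isFiniteMeasure s)
        (SimpleFunc.integrable_of_isFiniteMeasure t)
  have hsm : StronglyMeasurable X := Lp.stronglyMeasurable X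
  -- One uniformly bounded sequence serves both limits: dominated convergence under `μ` and `hcont`
  -- for `g`.
  let s : ℕ → SimpleFunc Ω ℝ := hsm.approxBounded ‖X‖
  have hsb : ∀ n ω, ‖s n ω‖ ≤ ‖X‖ := hsm.norm_approxBounded_le (norm_nonneg X)
  have hlim : ∀ᵐ ω ∂P, Tendsto (fun n => s n ω) atTop (𝓝 (X ω)) :=
    hsm.tendsto_approxBounded_ae (ae_abs_le_norm X)
  have h1 : Tendsto (fun n => ∫ ω, s n ω ∂μ) atTop (𝓝 (∫ ω, X ω ∂μ)) :=
    tendsto_integral_of_dominated_convergence (fun _ => ‖X‖)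
      (fun n => (s n).aestronglyMeasurable) (integrable_const _)
      (fun n => ae_of_all _ (hsb n)) (hac.ae_le hlim)
  have h2 : Tendsto (fun n => ∫ ω, s n ω ∂μ) atTop (𝓝 (g X)) := by
    simp_rw [hsimple]
    have hco := fun n => MemLp.coeFn_toLp (SimpleFunc.memLp_of_isFiniteMeasure (s n) ∞ P)
    refine hcont _ _ ‖X‖ (fun n => ?_) ?_
    · filter_upwards [hco n] with ω hω
      rw [hω]
      exact hsb n ω
    · filter_upwards [ae_all_iff.2 hco, hlim] with ω h3 h4
      simp_rw [h3]
      exact h4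
  exact tendsto_nhds_unique h1 h2

theorem le_const_norm [IsFiniteMeasure P] (X : Lp ℝ ∞ P) : X ≤ Lp.const ∞ P ‖X‖ := by
  rw [← Lp.coeFn_le]
  filter_upwards [ae_abs_le_norm X, Lp.coeFn_const (p := ∞) (μ := P) ‖X‖] with ω h1 h2
  rw [h2]
  exact (le_abs_self _).trans h1

theorem integral_coeFn_const [IsFiniteMeasure P] {μ : Measure Ω} [IsProbabilityMeasure μ] (hμ : μ ≪ P) (c : ℝ) :
    ∫ ω, Lp.const ∞ P c ω ∂μ = c := by
  rw [integral_congr_ae (hμ.ae_le (Lp.coeFn_const (p := ∞) (μ := P) c))]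
  simp

theorem integrable_of_absolutelyContinuous {μ : Measure Ω} [IsFiniteMeasure μ] (hμ : μ ≪ P)
    (X : Lp ℝ ∞ P) : Integrable X μ :=
  Integrable.of_bound (Lp.stronglyMeasurable X).aestronglyMeasurable ‖X‖
    (hμ.ae_le (ae_abs_le_norm X))

variable [IsProbabilityMeasure P] {ρ : Lp ℝ ∞ P → ℝ}

/-- The dual representation of Fatou coherent risk measures: `ρ X` is the supremum of the
expectations of `X` over the supporting set. -/
theorem IsCoherentRiskMeasure.exists_mem_supportingSet_lt (hρ : IsCoherentRiskMeasure ρ)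
    (hF : IsFatou ρ) (X : Lp ℝ ∞ P) {c : ℝ} (hc : c < ρ X) :
    ∃ μ ∈ supportingSet ρ, c < ∫ ω, X ω ∂μ := by
  set X₀ : Lp ℝ ∞ P := X + Lp.const ∞ P (-c) with hX₀
  have hX₀pos : 0 < ρ X₀ := by
    rw [hX₀, hρ.cash_invariant]
    linarith
  obtain ⟨g, hgA, hgX, hgc⟩ := hρ.exists_separating hF hX₀pos
  have hgpos : ∀ Y, 0 ≤ Y → 0 ≤ g Y := by
    intro Y hY
    have h := hgA (-Y) ((hρ.monotone (-Y) 0 (neg_nonpos.2 hY)).trans hρ.apply_zero.le)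
    rw [map_neg] at h
    linarith
  have hconst : ∀ a : ℝ, Lp.const ∞ P a = a • Lp.const ∞ P (1 : ℝ) := by
    intro a
    apply Lp.ext
    filter_upwards [Lp.coeFn_const (p := ∞) (μ := P) a, Lp.coeFn_const (p := ∞) (μ := P) (1 : ℝ),
      Lp.coeFn_smul a (Lp.const ∞ P (1 : ℝ))] with ω h1 h2 h3
    rw [h1, h3, Pi.smul_apply, h2]
    simp
  -- From `X₀ ≤ ‖X₀‖` and positivity of `g`, `0 < g X₀ ≤ ‖X₀‖ * g 1`; hence `g` can be normalised.
  have hg1 : 0 < g (Lp.const ∞ P 1) := by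
    have h := hgpos _ (sub_nonneg.2 (le_const_norm X₀))
    rw [map_sub, hconst ‖X₀‖, map_smul, smul_eq_mul] at h
    have h' : 0 < ‖X₀‖ * g (Lp.const ∞ P 1) := by linarith
    exact pos_of_mul_pos_right h' (norm_nonneg _)
  set a := (g (Lp.const ∞ P 1))⁻¹ with ha
  have hap : 0 < a := inv_pos.2 hg1
  obtain ⟨μ, hfin, hac, hμ⟩ := exists_measure_of_tendsto_of_tendsto_ae
    (a • (g : Lp ℝ ∞ P →ₗ[ℝ] ℝ)) (fun Y hY => mul_nonneg hap.le (hgpos Y hY))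
    (fun Z Y C hC hZ => (hgc Z Y C hC hZ).const_mul a)
  have hμ' : ∀ Y : Lp ℝ ∞ P, ∫ ω, Y ω ∂μ = a * g Y := hμ
  have hprob : IsProbabilityMeasure μ := by
    have h := hμ' (Lp.const ∞ P 1)
    rw [integral_congr_ae (hac.ae_le (Lp.coeFn_const (p := ∞) (μ := P) (1 : ℝ))), ha,
      inv_mul_cancel₀ hg1.ne'] at h
    simp only [Function.const_apply, integral_const, smul_eq_mul, mul_one] at h
    exact ⟨by rwa [measureReal_def, ENNReal.toReal_eq_one_iff] at h⟩
  have hshift : ∀ (Y : Lp ℝ ∞ P) (b : ℝ),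
      ∫ ω, (Y + Lp.const ∞ P b) ω ∂μ = ∫ ω, Y ω ∂μ + b := by
    intro Y b
    rw [hμ', map_add, mul_add, ← hμ', ← hμ', integral_coeFn_const hac]
  refine ⟨μ, ⟨hprob, hac, fun Y => ?_⟩, ?_⟩
  -- Cash invariance makes `Y - ρ Y` acceptable.
  · have h1 : g (Y + Lp.const ∞ P (-ρ Y)) ≤ 0 := hgA _ (by rw [hρ.cash_invariant]; linarith)
    have h2 := hshift Y (-ρ Y)
    rw [hμ'] at h2
    have := mul_nonpos_of_nonneg_of_nonpos hap.le h1
    linarith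
  · have h2 := hshift X (-c)
    rw [hμ'] at h2
    have := mul_pos hap hgX
    linarith

end Representation

/-! ### Conditional expectation, `L^∞(𝒢)` and densities -/

section CondExp

variable {Ω : Type*} {𝒢 m : MeasurableSpace Ω} {P : Measure Ω}

theorem coeFn_inclLInfty (h𝒢 : 𝒢 ≤ m) (X : LInftySub P h𝒢) : inclLInfty h𝒢 X =ᵐ[P] X :=
  MemLp.coeFn_toLp (memLp_of_memLp_trim h𝒢 (Lp.memLp X))

theorem coeFn_condExpLInfty (h𝒢 : 𝒢 ≤ m) (X : Lp ℝ ∞ P) :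
    condExpLInfty h𝒢 X =ᵐ[P] P[X | 𝒢] :=
  ae_eq_of_ae_eq_trim (MemLp.coeFn_toLp (memLp_condExp_trim h𝒢 X))

theorem coeFn_inclLInfty_condExpLInfty (h𝒢 : 𝒢 ≤ m) (X : Lp ℝ ∞ P) :
    inclLInfty h𝒢 (condExpLInfty h𝒢 X) =ᵐ[P] P[X | 𝒢] :=
  (coeFn_inclLInfty h𝒢 _).trans (coeFn_condExpLInfty h𝒢 X)

/-- Two `𝒢`-measurable representatives differ on a set of `𝒢`, so `P` and its trim agree on whether
it is null. -/
theorem LInftySub.ext_of_ae_eq {h𝒢 : 𝒢 ≤ m} {X Y : LInftySub P h𝒢} (h : X =ᵐ[P] Y) : X = Y :=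
  Lp.ext ((Lp.stronglyMeasurable X).ae_eq_trim_of_stronglyMeasurable h𝒢
    (Lp.stronglyMeasurable Y) h)

theorem inclLInfty_add (h𝒢 : 𝒢 ≤ m) (X Y : LInftySub P h𝒢) :
    inclLInfty h𝒢 (X + Y) = inclLInfty h𝒢 X + inclLInfty h𝒢 Y := by
  apply Lp.ext
  filter_upwards [coeFn_inclLInfty h𝒢 (X + Y), coeFn_inclLInfty h𝒢 X, coeFn_inclLInfty h𝒢 Y,
    Lp.coeFn_add (inclLInfty h𝒢 X) (inclLInfty h𝒢 Y), ae_of_ae_trim h𝒢 (Lp.coeFn_add X Y)]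
    with ω h1 h2 h3 h4 h5
  rw [h1, h4, h5, Pi.add_apply, Pi.add_apply, h2, h3]

theorem inclLInfty_smul (h𝒢 : 𝒢 ≤ m) (c : ℝ) (X : LInftySub P h𝒢) :
    inclLInfty h𝒢 (c • X) = c • inclLInfty h𝒢 X := by
  apply Lp.ext
  filter_upwards [coeFn_inclLInfty h𝒢 (c • X), coeFn_inclLInfty h𝒢 X,
    Lp.coeFn_smul c (inclLInfty h𝒢 X), ae_of_ae_trim h𝒢 (Lp.coeFn_smul c X)]
    with ω h1 h2 h4 h5
  rw [h1, h4, h5, Pi.smul_apply, Pi.smul_apply, h2]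

theorem inclLInfty_const [IsFiniteMeasure P] (h𝒢 : 𝒢 ≤ m) (c : ℝ) :
    inclLInfty h𝒢 (Lp.const ∞ (P.trim h𝒢) c) = Lp.const ∞ P c := by
  apply Lp.ext
  filter_upwards [coeFn_inclLInfty h𝒢 (Lp.const ∞ (P.trim h𝒢) c),
    Lp.coeFn_const (p := ∞) (μ := P) c,
    ae_of_ae_trim h𝒢 (Lp.coeFn_const (p := ∞) (μ := P.trim h𝒢) c)] with ω h1 h2 h3
  rw [h1, h2, h3]

theorem inclLInfty_mono (h𝒢 : 𝒢 ≤ m) {X Y : LInftySub P h𝒢} (h : X ≤ Y) :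
    inclLInfty h𝒢 X ≤ inclLInfty h𝒢 Y := by
  rw [← Lp.coeFn_le] at h ⊢
  filter_upwards [coeFn_inclLInfty h𝒢 X, coeFn_inclLInfty h𝒢 Y, ae_of_ae_trim h𝒢 h]
    with ω h1 h2 h3
  rwa [h1, h2]

theorem IsCoherentRiskMeasure.comp_inclLInfty [IsFiniteMeasure P] {ρ : Lp ℝ ∞ P → ℝ}
    (hρ : IsCoherentRiskMeasure ρ) (h𝒢 : 𝒢 ≤ m) :
    IsCoherentRiskMeasure fun X : LInftySub P h𝒢 => ρ (inclLInfty h𝒢 X) where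
  cash_invariant X c := by rw [inclLInfty_add, inclLInfty_const, hρ.cash_invariant]
  monotone X Y h := hρ.monotone _ _ (inclLInfty_mono h𝒢 h)
  convex X Y t h0 h1 := by
    rw [inclLInfty_add, inclLInfty_smul, inclLInfty_smul]
    exact hρ.convex _ _ t h0 h1
  pos_homogeneous X t ht := by rw [inclLInfty_smul, hρ.pos_homogeneous _ t ht]

theorem IsFatou.comp_inclLInfty {ρ : Lp ℝ ∞ P → ℝ} (hF : IsFatou ρ) (h𝒢 : 𝒢 ≤ m) :
    IsFatou fun X : LInftySub P h𝒢 => ρ (inclLInfty h𝒢 X) := by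
  rintro X Y ⟨C, hC⟩ hX
  refine hF (fun n => inclLInfty h𝒢 (X n)) (inclLInfty h𝒢 Y) ⟨C, fun n => ?_⟩ ?_
  · filter_upwards [coeFn_inclLInfty h𝒢 (X n), ae_of_ae_trim h𝒢 (hC n)] with ω h1 h2
    rwa [h1]
  · filter_upwards [ae_all_iff.2 fun n => coeFn_inclLInfty h𝒢 (X n), coeFn_inclLInfty h𝒢 Y,
      ae_of_ae_trim h𝒢 hX] with ω h1 h2 h3
    simp_rw [h1, h2]
    exact h3

theorem integrable_Lp_top [IsFiniteMeasure P] (X : Lp ℝ ∞ P) : Integrable X P :=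
  (Lp.memLp X).integrable le_top

/-- Conditioning is therefore onto `L^∞(𝒢)`, so (∗) determines `ρt` completely. -/
theorem condExpLInfty_inclLInfty [IsFiniteMeasure P] (h𝒢 : 𝒢 ≤ m) (Z : LInftySub P h𝒢) :
    condExpLInfty h𝒢 (inclLInfty h𝒢 Z) = Z := by
  apply LInftySub.ext_of_ae_eq
  refine (coeFn_condExpLInfty h𝒢 _).trans ?_
  refine (condExp_congr_ae (coeFn_inclLInfty h𝒢 Z)).trans ?_
  rw [condExp_of_stronglyMeasurable h𝒢 (Lp.stronglyMeasurable Z)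
    ((integrable_congr (coeFn_inclLInfty h𝒢 Z)).1 (integrable_Lp_top _))]

theorem condExpLInfty_sub [IsFiniteMeasure P] (h𝒢 : 𝒢 ≤ m) (X Y : Lp ℝ ∞ P) :
    condExpLInfty h𝒢 (X - Y) = condExpLInfty h𝒢 X - condExpLInfty h𝒢 Y := by
  apply LInftySub.ext_of_ae_eq
  filter_upwards [coeFn_condExpLInfty h𝒢 (X - Y), coeFn_condExpLInfty h𝒢 X,
    coeFn_condExpLInfty h𝒢 Y, condExp_congr_ae (m := 𝒢) (Lp.coeFn_sub X Y),
    condExp_sub (integrable_Lp_top X) (integrable_Lp_top Y) 𝒢,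
    ae_of_ae_trim h𝒢 (Lp.coeFn_sub (condExpLInfty h𝒢 X) (condExpLInfty h𝒢 Y))]
    with ω h1 h2 h3 h4 h5 h6
  rw [h1, h4, h5, h6, Pi.sub_apply, Pi.sub_apply, h2, h3]

theorem integral_mul_condExp [IsFiniteMeasure P] (h𝒢 : 𝒢 ≤ m) {f g : Ω → ℝ}
    (hf : AEStronglyMeasurable[𝒢] f P) (hfg : Integrable (f * g) P) (hg : Integrable g P) :
    ∫ ω, f ω * (P[g | 𝒢]) ω ∂P = ∫ ω, f ω * g ω ∂P := by
  rw [← integral_condExp h𝒢 (f := fun ω => f ω * g ω)]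
  exact (integral_congr_ae (condExp_mul_of_aestronglyMeasurable_left hf hfg hg)).symm

/-- Self-adjointness of conditioning: both sides equal `E[E[D|𝒢] E[X|𝒢]]`. Boundedness of `X` and of
`E[X|𝒢]` makes the products integrable for `D` merely in `L^1`. -/
theorem integral_condExp_mul_eq [IsFiniteMeasure P] (h𝒢 : 𝒢 ≤ m) {D : Ω → ℝ}
    (hD : Integrable D P) (X : Lp ℝ ∞ P) :
    ∫ ω, (P[D | 𝒢]) ω * X ω ∂P = ∫ ω, D ω * (P[X | 𝒢]) ω ∂P := by
  have hXb : ∀ᵐ ω ∂P, ‖X ω‖ ≤ ‖X‖ := ae_abs_le_norm X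
  have hcb : ∀ᵐ ω ∂P, ‖(P[X | 𝒢]) ω‖ ≤ ‖inclLInfty h𝒢 (condExpLInfty h𝒢 X)‖ := by
    filter_upwards [coeFn_inclLInfty_condExpLInfty h𝒢 X,
      ae_abs_le_norm (inclLInfty h𝒢 (condExpLInfty h𝒢 X))] with ω h1 h2
    rwa [← h1]
  rw [← integral_mul_condExp h𝒢 stronglyMeasurable_condExp.aestronglyMeasurable
    (integrable_condExp.mul_bdd (Lp.aestronglyMeasurable X) hXb) (integrable_Lp_top X)]
  have h := integral_mul_condExp h𝒢 (f := P[X | 𝒢]) (g := D)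
    stronglyMeasurable_condExp.aestronglyMeasurable
    (hD.bdd_mul integrable_condExp.aestronglyMeasurable hcb) hD
  simp_rw [mul_comm (D _), ← h, mul_comm]

theorem integral_eq_integral_rnDeriv_mul [IsFiniteMeasure P] {μ : Measure Ω} [IsFiniteMeasure μ]
    (hμ : μ ≪ P) (f : Ω → ℝ) : ∫ ω, f ω ∂μ = ∫ ω, (μ.rnDeriv P ω).toReal * f ω ∂P :=
  (integral_rnDeriv_smul hμ).symm

/-- The density of `μ` is `𝒢`-measurable if and only if `μ`-expectations on `L^∞` do not change
under conditioning on `𝒢`. -/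
theorem aestronglyMeasurable_rnDeriv_iff [IsFiniteMeasure P] (h𝒢 : 𝒢 ≤ m) {μ : Measure Ω}
    [IsFiniteMeasure μ] (hμ : μ ≪ P) :
    AEStronglyMeasurable[𝒢] (fun ω => (μ.rnDeriv P ω).toReal) P ↔
      ∀ X : Lp ℝ ∞ P, ∫ ω, X ω ∂μ = ∫ ω, inclLInfty h𝒢 (condExpLInfty h𝒢 X) ω ∂μ := by
  have hint : Integrable (fun ω => (μ.rnDeriv P ω).toReal) P := Measure.integrable_toReal_rnDeriv
  have hcond : ∀ X : Lp ℝ ∞ P, ∫ ω, inclLInfty h𝒢 (condExpLInfty h𝒢 X) ω ∂μ =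
      ∫ ω, (μ.rnDeriv P ω).toReal * (P[X | 𝒢]) ω ∂P := fun X => by
    rw [integral_congr_ae (hμ.ae_le (coeFn_inclLInfty_condExpLInfty h𝒢 X)),
      integral_eq_integral_rnDeriv_mul hμ]
  constructor
  · intro hD X
    rw [hcond, integral_mul_condExp h𝒢 hD (hint.mul_bdd (Lp.aestronglyMeasurable X)
      (ae_abs_le_norm X)) (integrable_Lp_top X), integral_eq_integral_rnDeriv_mul hμ]
  · intro h
    -- Testing the hypothesis on indicators and moving the conditioning onto the density gives equal
    -- integrals over every measurable `A`, not only those in `𝒢`.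
    have heq : (fun ω => (μ.rnDeriv P ω).toReal) =ᵐ[P]
        P[fun ω => (μ.rnDeriv P ω).toReal | 𝒢] := by
      refine hint.ae_eq_of_forall_setIntegral_eq _ _ integrable_condExp fun A hA _ => ?_
      let X : Lp ℝ ∞ P := indicatorConstLp ∞ hA (measure_ne_top P A) (1 : ℝ)
      have hX : X =ᵐ[P] A.indicator fun _ => (1 : ℝ) := indicatorConstLp_coeFn
      have hset : ∀ f : Ω → ℝ, ∫ ω, f ω * X ω ∂P = ∫ ω in A, f ω ∂P := by
        intro f
        rw [← integral_indicator hA]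
        refine integral_congr_ae ?_
        filter_upwards [hX] with ω hω
        rw [hω]
        by_cases hωA : ω ∈ A <;> simp [hωA]
      rw [← hset, ← hset, integral_condExp_mul_eq h𝒢 hint, ← integral_eq_integral_rnDeriv_mul hμ,
        h X, hcond]
    exact stronglyMeasurable_condExp.aestronglyMeasurable.congr heq.symm

/-- Removes densities from (iv): the duality arguments need only expectations under supporting
measures. -/
theorem supportingDensities_subset_lpMeas_iff [IsFiniteMeasure P] (h𝒢 : 𝒢 ≤ m)
    (ρ : Lp ℝ ∞ P → ℝ) :
    supportingDensities ρ ⊆ (lpMeas ℝ ℝ 𝒢 1 P : Set (Lp ℝ 1 P)) ↔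
      ∀ μ ∈ supportingSet ρ, ∀ X : Lp ℝ ∞ P,
        ∫ ω, X ω ∂μ = ∫ ω, inclLInfty h𝒢 (condExpLInfty h𝒢 X) ω ∂μ := by
  constructor
  · intro h μ hμ
    have := hμ.1
    have hint : Integrable (fun ω => (μ.rnDeriv P ω).toReal) P :=
      Measure.integrable_toReal_rnDeriv
    have hD := hint.coeFn_toL1
    have hmem := mem_lpMeas_iff_aestronglyMeasurable.1 (h ⟨μ, hμ, hD⟩)
    exact (aestronglyMeasurable_rnDeriv_iff h𝒢 hμ.2.1).1 (hmem.congr hD)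
  · rintro h D ⟨μ, hμ, hD⟩
    have := hμ.1
    exact mem_lpMeas_iff_aestronglyMeasurable.2
      (((aestronglyMeasurable_rnDeriv_iff h𝒢 hμ.2.1).2 (h μ hμ)).congr hD.symm)

theorem map_inclLInfty (h𝒢 : 𝒢 ≤ m) (Z : LInftySub P h𝒢) :
    Measure.map (inclLInfty h𝒢 Z) P = @Measure.map Ω ℝ 𝒢 _ Z (P.trim h𝒢) := by
  have hZ : Measurable[𝒢] Z := (Lp.stronglyMeasurable Z).measurable
  rw [Measure.map_congr (coeFn_inclLInfty h𝒢 Z)]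
  ext s hs
  rw [Measure.map_apply (hZ.mono h𝒢 le_rfl) hs, @Measure.map_apply Ω ℝ 𝒢 _ _ _ hZ _ hs,
    trim_measurableSet_eq h𝒢 (hZ hs)]

theorem identDistrib_inclLInfty_iff (h𝒢 : 𝒢 ≤ m) (X Y : LInftySub P h𝒢) :
    IdentDistrib (inclLInfty h𝒢 X) (inclLInfty h𝒢 Y) P P ↔
      @IdentDistrib Ω Ω ℝ 𝒢 𝒢 _ X Y (P.trim h𝒢) (P.trim h𝒢) := by
  constructor
  · intro h
    exact @IdentDistrib.mk Ω Ω ℝ 𝒢 𝒢 _ X Y (P.trim h𝒢) (P.trim h𝒢)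
      (Lp.stronglyMeasurable X).measurable.aemeasurable
      (Lp.stronglyMeasurable Y).measurable.aemeasurable
      ((map_inclLInfty h𝒢 X).symm.trans (h.map_eq.trans (map_inclLInfty h𝒢 Y)))
  · intro h
    refine ⟨(Lp.stronglyMeasurable (inclLInfty h𝒢 X)).measurable.aemeasurable,
      (Lp.stronglyMeasurable (inclLInfty h𝒢 Y)).measurable.aemeasurable, ?_⟩
    rw [map_inclLInfty, map_inclLInfty]
    exact @IdentDistrib.map_eq Ω Ω ℝ 𝒢 𝒢 _ _ _ _ _ h

/-- A `𝒢`-measurable class is its own conditional expectation, which supplies the preimage. -/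
theorem mem_lpMeas_iff_exists_inclLInfty [IsFiniteMeasure P] (h𝒢 : 𝒢 ≤ m) (X : Lp ℝ ∞ P) :
    X ∈ lpMeas ℝ ℝ 𝒢 ∞ P ↔ ∃ Z : LInftySub P h𝒢, inclLInfty h𝒢 Z = X := by
  rw [mem_lpMeas_iff_aestronglyMeasurable]
  constructor
  · intro h
    refine ⟨condExpLInfty h𝒢 X, Lp.ext ?_⟩
    exact (coeFn_inclLInfty_condExpLInfty h𝒢 X).trans
      (condExp_of_aestronglyMeasurable' h𝒢 h (integrable_Lp_top X))
  · rintro ⟨Z, rfl⟩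
    exact ⟨Z, Lp.stronglyMeasurable Z, coeFn_inclLInfty h𝒢 Z⟩

theorem isPartiallyLawInvariant_iff [IsFiniteMeasure P] (h𝒢 : 𝒢 ≤ m) (ρ : Lp ℝ ∞ P → ℝ) :
    IsPartiallyLawInvariant 𝒢 ρ ↔
      IsLawInvariant fun X : LInftySub P h𝒢 => ρ (inclLInfty h𝒢 X) := by
  constructor
  · intro h X Y hXY
    exact h _ _ ((mem_lpMeas_iff_exists_inclLInfty h𝒢 _).2 ⟨X, rfl⟩)
      ((mem_lpMeas_iff_exists_inclLInfty h𝒢 _).2 ⟨Y, rfl⟩)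
      ((identDistrib_inclLInfty_iff h𝒢 X Y).2 hXY)
  · intro h X Y hX hY hXY
    obtain ⟨X, rfl⟩ := (mem_lpMeas_iff_exists_inclLInfty h𝒢 X).1 hX
    obtain ⟨Y, rfl⟩ := (mem_lpMeas_iff_exists_inclLInfty h𝒢 Y).1 hY
    exact h X Y ((identDistrib_inclLInfty_iff h𝒢 X Y).1 hXY)

end CondExp

/-! ### The equivalences and law invariance -/

theorem mainTheorem7 {Ω : Type*} {𝒢 m : MeasurableSpace Ω} (P : Measure Ω) [IsProbabilityMeasure P]
    (h𝒢 : 𝒢 ≤ m)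
    (ρ : Lp ℝ ∞ P → ℝ) (hρ : IsCoherentRiskMeasure ρ) (hFatou : IsFatou ρ) :
    [∃ ρt : LInftySub P h𝒢 → ℝ, IsCoherentRiskMeasure ρt ∧ IsFatou ρt ∧
        ∀ X : Lp ℝ ∞ P, ρ X = ρt (condExpLInfty h𝒢 X),
      ∃ ρt : LInftySub P h𝒢 → ℝ, ∀ X : Lp ℝ ∞ P, ρ X = ρt (condExpLInfty h𝒢 X),
      ∀ X : Lp ℝ ∞ P, ρ X = ρ (inclLInfty h𝒢 (condExpLInfty h𝒢 X)),
      supportingDensities ρ ⊆ (lpMeas ℝ ℝ 𝒢 1 P : Set (Lp ℝ 1 P))].TFAE ∧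
    ∀ ρt : LInftySub P h𝒢 → ℝ, (∀ X : Lp ℝ ∞ P, ρ X = ρt (condExpLInfty h𝒢 X)) →
      (IsPartiallyLawInvariant 𝒢 ρ ↔ IsLawInvariant ρt) := by
  have hincl : ∀ ρt : LInftySub P h𝒢 → ℝ, (∀ X : Lp ℝ ∞ P, ρ X = ρt (condExpLInfty h𝒢 X)) →
      ∀ Z, ρ (inclLInfty h𝒢 Z) = ρt Z := fun ρt h Z => by
    rw [h, condExpLInfty_inclLInfty]
  constructor
  · tfae_have 1 → 2 := fun ⟨ρt, _, _, h⟩ => ⟨ρt, h⟩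
    tfae_have 2 → 3 := fun ⟨ρt, h⟩ X => by rw [hincl ρt h, h]
    tfae_have 3 → 1 := fun h =>
      ⟨fun X => ρ (inclLInfty h𝒢 X), hρ.comp_inclLInfty h𝒢, hFatou.comp_inclLInfty h𝒢, h⟩
    tfae_have 3 → 4 := by
      intro h
      rw [supportingDensities_subset_lpMeas_iff h𝒢]
      intro μ hμ X
      have := hμ.1
      set Y := inclLInfty h𝒢 (condExpLInfty h𝒢 X) with hY
      have hsame : condExpLInfty h𝒢 Y = condExpLInfty h𝒢 X := condExpLInfty_inclLInfty h𝒢 _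
      have h0 : ∀ Z W : Lp ℝ ∞ P, condExpLInfty h𝒢 Z = condExpLInfty h𝒢 W →
          ∫ ω, Z ω ∂μ ≤ ∫ ω, W ω ∂μ := by
        intro Z W hZW
        have h1 : ρ (Z - W) = 0 := by
          -- Zero is rewritten as the conditional expectation of `0 - 0`, so that `h` read backwards
          -- returns `ρ 0`.
          rw [h, condExpLInfty_sub, hZW, sub_self, ← sub_self (condExpLInfty h𝒢 (0 : Lp ℝ ∞ P)),
            ← condExpLInfty_sub, ← h, sub_self, hρ.apply_zero]
        have h2 := hμ.2.2 (Z - W)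
        rw [h1, integral_congr_ae (hμ.2.1.ae_le (Lp.coeFn_sub Z W)),
          integral_sub' (integrable_of_absolutelyContinuous hμ.2.1 Z)
            (integrable_of_absolutelyContinuous hμ.2.1 W)] at h2
        linarith
      exact le_antisymm (h0 X Y hsame.symm) (h0 Y X hsame)
    tfae_have 4 → 3 := by
      intro h X
      rw [supportingDensities_subset_lpMeas_iff h𝒢] at h
      apply le_antisymm
      · by_contra! hlt
        obtain ⟨μ, hμ, hμX⟩ := hρ.exists_mem_supportingSet_lt hFatou _ hlt
        rw [h μ hμ X] at hμX
        exact (hμ.2.2 _).not_gt hμX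
      · by_contra! hlt
        obtain ⟨μ, hμ, hμX⟩ := hρ.exists_mem_supportingSet_lt hFatou _ hlt
        rw [← h μ hμ X] at hμX
        exact (hμ.2.2 _).not_gt hμX
    tfae_finish
  · intro ρt h
    rw [isPartiallyLawInvariant_iff h𝒢, funext (hincl ρt h)]
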